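/- Let $f\colon\{0,1\}^n\to\{0,1,\perp\}$ be a partial Boolean function (the value $\perp$ means "undefined") and let $F(x,y)=f(x\oplus y)$ for $x,y\in\{0,1\}^n$, where $\oplus$ is bitwise XOR. Let $\mathrm{D_{cc}^{\rightarrow}}(F)$ be the least $t$ for which there are total functions $h\colon\{0,1\}^n\to\{0,1\}^t$ and $\varphi\colon\{0,1\}^t\times\{0,1\}^n\to\{0,1\}$ with $\varphi(h(x),y)=F(x,y)$ whenever $F(x,y)\neq\perp$. Let $\mathrm{NADT^{\oplus}}(f)$ be the least $p$ for which there are strings $s_1,\dots,s_p\in\{0,1\}^n$ and a total function $l\colon\{0,1\}^p\to\{0,1\}$ with $l(\langle s_1,x\rangle,\dots,\langle s_p,x\rangle)=f(x)$ whenever $f(x)\neq\perp$, where $\langle s,x\rangle=\bigoplus_i s_i\wedge x_i$. **Theorem.** Suppose $\mathrm{D_{cc}^{\rightarrow}}(F)=t$ and $f$ is undefined on fewer than $$\binom{n-t+1}{\lfloor (n-t)/2\rfloor-1}$$ inputs, where a binomial coefficient with negative lower index is $0$. Then $\mathrm{NADT^{\oplus}}(f)=t$. Moreover, this threshold is of order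 $2^{n-t}/\sqrt{n-t}$: as $m\to\infty$, $\binom{m+1}{\lfloor m/2\rfloor-1}=\Theta\!\left(2^m/\sqrt m\right)$; in particular it is $O\!\left(2^m/\sqrt m\right)$. -/

import Mathlib

open scoped Matrix

/-- The Boolean cube `{0,1}^n`, identified with the vector space `𝔽₂^n`; its addition `+` is
bitwise XOR. -/
abbrev Cube (n : ℕ) : Type := Fin n → ZMod 2

/-- A partial Boolean function `{0,1}^n → {0,1,⊥}`; the value `none` is `⊥` (undefined). -/
abbrev PartialBoolFun (n : ℕ) : Type := Cube n → Option (ZMod 2)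

/-- The inputs on which `f` is undefined. -/
def undefinedInputs {n : ℕ} (f : PartialBoolFun n) : Finset (Cube n) :=
  Finset.univ.filter fun x => f x = none

/-- The XOR-function `F(x, y) = f(x ⊕ y)` of a partial function `f`. -/
def xorFun {n : ℕ} (f : PartialBoolFun n) : Cube n → Cube n → Option (ZMod 2) :=
  fun x y => f (x + y)

/-- `F` has a one-way protocol with `t` bits of communication: Alice sends `h x`, Bob outputs
`φ (h x) y`, and this output is correct wherever `F` is defined. -/
def HasOneWayProtocol {n : ℕ} (F : Cube n → Cube n → Option (ZMod 2)) (t : ℕ) : Prop :=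
  ∃ (h : Cube n → Cube t) (φ : Cube t → Cube n → ZMod 2),
    ∀ (x y : Cube n) (b : ZMod 2), F x y = some b → φ (h x) y = b

/-- One-way deterministic communication complexity: the least number of bits of a one-way
protocol. -/
noncomputable def oneWayCC {n : ℕ} (F : Cube n → Cube n → Option (ZMod 2)) : ℕ :=
  sInf {t | HasOneWayProtocol F t}

/-- `f` has a non-adaptive parity decision tree with `p` queries: strings `s₁, …, s_p` and a total
function `l` such that `l (⟨s₁, x⟩, …, ⟨s_p, x⟩) = f x` wherever `f` is defined. -/
def HasNADT {n : ℕ} (f : PartialBoolFun n) (p : ℕ) : Prop :=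
  ∃ (s : Fin p → Cube n) (l : Cube p → ZMod 2),
    ∀ (x : Cube n) (b : ZMod 2), f x = some b → l (fun i => s i ⬝ᵥ x) = b

/-- Non-adaptive parity decision tree complexity: the least number of queries. -/
noncomputable def nadt {n : ℕ} (f : PartialBoolFun n) : ℕ :=
  sInf {p | HasNADT f p}

/-- The minimum in `oneWayCC` is over a non-empty set: Alice can send her whole input. -/
theorem hasOneWayProtocol_self {n : ℕ} (F : Cube n → Cube n → Option (ZMod 2)) :
    HasOneWayProtocol F n :=
  ⟨id, fun x y => (F x y).getD 0, fun x y b hb => by simp [hb]⟩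

/-- The minimum in `nadt` is over a non-empty set: one can query every bit. -/
theorem hasNADT_self {n : ℕ} (f : PartialBoolFun n) : HasNADT f n :=
  ⟨fun i => Pi.single i 1, fun x => (f x).getD 0, fun x b hb => by simp [hb]⟩

/-- The binomial coefficient with an integer lower index, equal to `0` if that index is
negative. -/
def intChoose (m : ℕ) (k : ℤ) : ℕ :=
  if 0 ≤ k then m.choose k.toNat else 0

/-- The threshold `binom(m + 1, ⌊m / 2⌋ - 1)`, to be used with `m = n - t`. -/
def undefinedThreshold (m : ℕ) : ℕ :=
  intChoose (m + 1) ((m : ℤ) / 2 - 1)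

/-!
Take a largest fibre of Alice's message function and translate it to a set `D` containing `0`; it
has at least `2 ^ (n - t)` elements, and every `x` comes with a single bit `ψ x` to which `f` is
equal wherever it is defined on `x + D`. On a coset of the span `V` of `D`, let `X` be the set on
which `ψ = 0`; then `f` is undefined on `(X + D) ∩ (Xᶜ + D)`. If `f` took both values on the coset,
then `X` and `Xᶜ` would be nonempty, and Olson's inequality `|X + D| ≥ |X| + |D| / 2`, applied to
both, would make this intersection at least as large as `D`. So if `f` is undefined on fewer than
`2 ^ (n - t)` inputs, it is constant on the cosets of `V`, which has codimension at most `t`.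

Olson's inequality is proved by Hamidoune's method. Among the nonempty sets with `X + D ≠ G`
minimize `|X + D| - |X|`, and then `|X|`. By submodularity two translates of a minimizer which meet
are equal, so the minimizer through `0` is a subgroup `H`; and `H + D` contains both `D` and two
cosets of `H`.
-/

section SumsetGrowth

open Finset
open scoped Pointwise

variable {G : Type*} [AddGroup G] [DecidableEq G] {D X Y : Finset G}

theorem card_inter_add_add_card_union_add_le (X Y D : Finset G) :
    #(X ∩ Y + D) + #(X ∪ Y + D) ≤ #(X + D) + #(Y + D) := by
  rw [union_add, ← card_inter_add_card_union (X + D)]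
  gcongr
  exact inter_add_subset

theorem two_mul_card_le_card_addSubgroup_add {H : AddSubgroup G} {K : Finset G}
    (hK : (K : Set G) = H) (h0 : 0 ∈ D) {d : G} (hd : d ∈ D) (hdH : d ∉ H) :
    2 * #K ≤ #(K + D) := by
  have hmem (z : G) : z ∈ K ↔ z ∈ H := by rw [← mem_coe, hK, SetLike.mem_coe]
  have hdisj : Disjoint K (K + {d}) := by
    rw [disjoint_left]
    intro z hz hzd
    obtain ⟨y, hy, e, he, rfl⟩ := mem_add.1 hzd
    rw [mem_singleton.1 he] at hz
    rw [hmem] at hy hz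
    exact hdH ((H.add_mem_cancel_left hy).1 hz)
  calc 2 * #K = #K + #(K + {d}) := by rw [card_add_singleton, two_mul]
    _ = #(K ∪ (K + {d})) := (card_union_of_disjoint hdisj).symm
    _ ≤ #(K + D) := card_le_card <| union_subset (subset_add_left K h0) <|
        add_subset_add_left (singleton_subset_iff.2 hd)

variable [Fintype G]

theorem compl_add_add_subset_compl (hneg : -D = D) : (X + D)ᶜ + D ⊆ Xᶜ := by
  intro z hz
  obtain ⟨y, hy, d, hd, rfl⟩ := mem_add.1 hz
  rw [mem_compl] at hy ⊢
  have hnegd : -d ∈ D := hneg ▸ neg_mem_neg hd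
  exact fun hyd => hy (by simpa using add_mem_add hyd hnegd)

/-- Hamidoune's fragments of `D`: the nonempty sets `X` with `X + D ≠ G` whose growth
`|X + D| - |X|` is minimal. The subtraction does not truncate when `0 ∈ D`. -/
def IsAddFragment (D X : Finset G) : Prop :=
  MinimalFor (fun Y : Finset G => Y.Nonempty ∧ Y + D ≠ univ) (fun Y => #(Y + D) - #Y) X

/-- Hamidoune's atoms of `D`: the fragments of least cardinality. -/
def IsAddAtom (D X : Finset G) : Prop :=
  MinimalFor (IsAddFragment D) card X

theorem exists_isAddAtom (hX : X.Nonempty) (hXD : X + D ≠ univ) : ∃ Y, IsAddAtom D Y :=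
  exists_minimalFor_of_wellFoundedLT _ _ <| exists_minimalFor_of_wellFoundedLT _ _ ⟨X, hX, hXD⟩

theorem IsAddFragment.card_add_card_le (hX : IsAddFragment D X) (h0 : 0 ∈ D) (hY : Y.Nonempty)
    (hYD : Y + D ≠ univ) : #(X + D) + #Y ≤ #(Y + D) + #X := by
  have hXcard : #X ≤ #(X + D) := card_le_card (subset_add_left X h0)
  have hYcard : #Y ≤ #(Y + D) := card_le_card (subset_add_left Y h0)
  have hmin := hX.2 ⟨hY, hYD⟩
  dsimp only at hmin
  omega

theorem IsAddFragment.of_card_add_card_le (hX : IsAddFragment D X) (h0 : 0 ∈ D)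
    (hY : Y.Nonempty) (hYD : Y + D ≠ univ) (hYX : #(Y + D) + #X ≤ #(X + D) + #Y) :
    IsAddFragment D Y := by
  refine ⟨⟨hY, hYD⟩, fun Z hZ _ => ?_⟩
  have hZX := hX.card_add_card_le h0 hZ.1 hZ.2
  dsimp only
  omega

theorem IsAddFragment.vadd (hX : IsAddFragment D X) (g : G) : IsAddFragment D (g +ᵥ X) := by
  refine ⟨⟨hX.1.1.vadd_finset, fun huniv => hX.1.2 ?_⟩, fun Y hY hYX => ?_⟩
  · rwa [vadd_add_assoc, ← card_eq_iff_eq_univ, card_vadd_finset, card_eq_iff_eq_univ] at huniv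
  · simp only [vadd_add_assoc, card_vadd_finset] at hYX ⊢
    exact hX.2 hY hYX

theorem IsAddAtom.vadd (hX : IsAddAtom D X) (g : G) : IsAddAtom D (g +ᵥ X) := by
  refine ⟨hX.1.vadd g, fun Y hY hYX => ?_⟩
  rw [card_vadd_finset] at hYX ⊢
  exact hX.2 hY hYX

theorem IsAddFragment.compl_add (hX : IsAddFragment D X) (h0 : 0 ∈ D) (hneg : -D = D) :
    IsAddFragment D (X + D)ᶜ := by
  have hsub : (X + D)ᶜ + D ⊆ Xᶜ := compl_add_add_subset_compl hneg
  refine hX.of_card_add_card_le h0 ?_ (fun huniv => ?_) ?_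
  · rw [nonempty_iff_ne_empty, Ne, compl_eq_empty_iff]
    exact hX.1.2
  · obtain ⟨x, hx⟩ := hX.1.1
    exact mem_compl.1 (hsub (huniv ▸ mem_univ x)) hx
  · have hcard := card_le_card hsub
    have hXcard := card_add_card_compl X
    have hXDcard := card_add_card_compl (X + D)
    omega

theorem IsAddAtom.card_add_card_add_le (hX : IsAddAtom D X) (h0 : 0 ∈ D) (hneg : -D = D) :
    #X + #(X + D) ≤ Fintype.card G := by
  have hmin := hX.2 (hX.1.compl_add h0 hneg)
  have hcompl := card_add_card_compl (X + D)
  omega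

theorem IsAddFragment.inter (hX : IsAddFragment D X) (hY : IsAddFragment D Y) (h0 : 0 ∈ D)
    (hXY : (X ∩ Y).Nonempty) (hcard : #X + #(Y + D) ≤ Fintype.card G) :
    IsAddFragment D (X ∩ Y) := by
  refine hX.of_card_add_card_le h0 hXY (fun huniv => hX.1.2 ?_) ?_
  · exact univ_subset_iff.1 (huniv ▸ add_subset_add_right inter_subset_left)
  · have hsubmod := card_inter_add_add_card_union_add_le X Y D
    have hinter := card_inter_add_card_union X Y
    by_cases huniv : X ∪ Y + D = univ
    · rw [huniv, card_univ] at hsubmod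
      omega
    · have hunion := hY.card_add_card_le h0 (hXY.mono inter_subset_union) huniv
      omega

theorem IsAddAtom.vadd_eq_of_inter_nonempty (hX : IsAddAtom D X) (h0 : 0 ∈ D) (hneg : -D = D)
    {g : G} (hg : (X ∩ (g +ᵥ X)).Nonempty) : g +ᵥ X = X := by
  have hcard := hX.card_add_card_add_le h0 hneg
  have hinter : IsAddFragment D (X ∩ (g +ᵥ X)) :=
    hX.1.inter (hX.1.vadd g) h0 hg (by rwa [vadd_add_assoc, card_vadd_finset])
  have hle : #X ≤ #(X ∩ (g +ᵥ X)) := hX.2 hinter (card_le_card inter_subset_left)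
  have heq : X ∩ (g +ᵥ X) = X := eq_of_subset_of_card_le inter_subset_left hle
  exact (eq_of_subset_of_card_le (inter_eq_left.1 heq) (card_vadd_finset g X).le).symm

theorem IsAddAtom.mem_stabilizer_iff (hX : IsAddAtom D X) (h0 : 0 ∈ D) (hneg : -D = D)
    (h0X : 0 ∈ X) {g : G} : g ∈ AddAction.stabilizer G X ↔ g ∈ X := by
  have hmem : g ∈ g +ᵥ X := by simpa using vadd_mem_vadd_finset (a := g) h0X
  rw [AddAction.mem_stabilizer_iff]
  exact ⟨fun hg => hg ▸ hmem, fun hg =>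
    hX.vadd_eq_of_inter_nonempty h0 hneg ⟨g, mem_inter.2 ⟨hg, hmem⟩⟩⟩

theorem IsAddAtom.exists_addSubgroup (hX : IsAddAtom D X) (h0 : 0 ∈ D) (hneg : -D = D) :
    ∃ (H : AddSubgroup G) (K : Finset G), (K : Set G) = H ∧ IsAddAtom D K := by
  obtain ⟨x, hx⟩ := hX.1.1.1
  have hK : IsAddAtom D (-x +ᵥ X) := hX.vadd (-x)
  have h0K : 0 ∈ -x +ᵥ X := mem_vadd_finset.2 ⟨x, hx, by simp⟩
  exact ⟨_, _, Set.ext fun g => (hK.mem_stabilizer_iff h0 hneg h0K).symm, hK⟩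

/-- Olson's inequality for a symmetric set. -/
theorem two_mul_card_add_card_le (h0 : 0 ∈ D) (hneg : -D = D)
    (htop : AddSubgroup.closure (D : Set G) = ⊤) (hX : X.Nonempty) (hXD : X + D ≠ univ) :
    2 * #X + #D ≤ 2 * #(X + D) := by
  obtain ⟨Y, hY⟩ := exists_isAddAtom hX hXD
  obtain ⟨H, K, hKH, hK⟩ := hY.exists_addSubgroup h0 hneg
  obtain ⟨d, hd, hdH⟩ : ∃ d ∈ D, d ∉ H := by
    by_contra! hDH
    have hH : H = ⊤ := top_le_iff.1 (htop ▸ (AddSubgroup.closure_le H).2 hDH)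
    refine hK.1.1.2 (univ_subset_iff.1 fun z _ => subset_add_left K h0 ?_)
    simp [← mem_coe, hKH, hH]
  have h0K : 0 ∈ K := by simp [← mem_coe, hKH]
  have hKcard : 2 * #K ≤ #(K + D) := two_mul_card_le_card_addSubgroup_add hKH h0 hd hdH
  have hDcard : #D ≤ #(K + D) := card_le_card (subset_add_right D h0K)
  have hmin := hK.1.card_add_card_le h0 hX hXD
  omega

theorem card_le_card_add_inter_compl_add (h0 : 0 ∈ D) (hneg : -D = D)
    (htop : AddSubgroup.closure (D : Set G) = ⊤) (hX : X.Nonempty) (hXc : Xᶜ.Nonempty) :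
    #D ≤ #((X + D) ∩ (Xᶜ + D)) := by
  by_cases hXD : X + D = univ
  · rw [hXD, univ_inter]
    exact card_le_card_add_left hXc
  by_cases hXcD : Xᶜ + D = univ
  · rw [hXcD, inter_univ]
    exact card_le_card_add_left hX
  have holson := two_mul_card_add_card_le h0 hneg htop hX hXD
  have holson_compl := two_mul_card_add_card_le h0 hneg htop hXc hXcD
  have hcompl := card_add_card_compl X
  have hinter := card_inter_add_card_union (X + D) (Xᶜ + D)
  have hunion := card_le_univ ((X + D) ∪ (Xᶜ + D))
  omega

end SumsetGrowth

section TranslatePredictors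

open Finset
open scoped Pointwise

variable {G α : Type*} [AddGroup G]

/-- `ψ x` is the value of the partial function `f` at each point of the translate `x + D` at which
`f` is defined. -/
def PredictsTranslates (ψ : G → α) (f : G → Option α) (D : Finset G) : Prop :=
  ∀ d ∈ D, ∀ x b, f (x + d) = some b → ψ x = b

variable [DecidableEq G] {D U : Finset G} {f : G → Option α} {ψ : G → α}

theorem PredictsTranslates.inter_compl_subset [Fintype G] [DecidableEq α]
    (hψ : PredictsTranslates ψ f D) (hU : ∀ x, f x = none → x ∈ U) (a : α) :
    (({x | ψ x = a} : Finset G) + D) ∩ (({x | ψ x = a} : Finset G)ᶜ + D) ⊆ U := by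
  intro z hz
  obtain ⟨hz₁, hz₂⟩ := mem_inter.1 hz
  obtain ⟨u, hu, d, hd, rfl⟩ := mem_add.1 hz₁
  obtain ⟨v, hv, e, he, hve⟩ := mem_add.1 hz₂
  rw [mem_filter_univ] at hu
  rw [mem_compl, mem_filter_univ] at hv
  refine hU _ (Option.eq_none_iff_forall_ne_some.2 fun c hc => hv ?_)
  rw [hψ e he v c (hve ▸ hc), ← hψ d hd u c hc, hu]

theorem PredictsTranslates.eq_of_closure_eq_top [Finite G] (hψ : PredictsTranslates ψ f D)
    (h0 : 0 ∈ D) (hneg : -D = D) (htop : AddSubgroup.closure (D : Set G) = ⊤)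
    (hU : ∀ x, f x = none → x ∈ U) (hUD : #U < #D) {x y : G} {a b : α}
    (hx : f x = some a) (hy : f y = some b) : a = b := by
  classical
  have := Fintype.ofFinite G
  by_contra! hab
  have hψx : ψ x = a := hψ 0 h0 x a (by rwa [add_zero])
  have hψy : ψ y = b := hψ 0 h0 y b (by rwa [add_zero])
  have hD : #D ≤ #((({x | ψ x = a} : Finset G) + D) ∩ (({x | ψ x = a} : Finset G)ᶜ + D)) :=
    card_le_card_add_inter_compl_add h0 hneg htop
      ⟨x, by simpa using hψx⟩ ⟨y, by simpa [hψy] using hab.symm⟩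
  exact (hD.trans (card_le_card (hψ.inter_compl_subset hU a))).not_gt hUD

theorem PredictsTranslates.eq_of_neg_add_mem_closure [Finite G] (hψ : PredictsTranslates ψ f D)
    (h0 : 0 ∈ D) (hneg : -D = D) (hU : ∀ x, f x = none → x ∈ U) (hUD : #U < #D) {x y : G}
    (hxy : -x + y ∈ AddSubgroup.closure (D : Set G)) {a b : α}
    (hx : f x = some a) (hy : f y = some b) : a = b := by
  classical
  have := Fintype.ofFinite G
  let H := AddSubgroup.closure (D : Set G)
  let DH : Finset H := {d | (d : G) ∈ D}
  let UH : Finset H := {v | x + v ∈ U}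
  have hψH : PredictsTranslates (fun v : H => ψ (x + v)) (fun v => f (x + v)) DH :=
    fun d hd v c hc => hψ d ((mem_filter_univ d).1 hd) (x + v) c (by rwa [add_assoc])
  have hnegH : -DH = DH := by
    ext d
    rw [mem_neg', mem_filter_univ, mem_filter_univ, AddSubgroup.coe_neg, ← mem_neg', hneg]
  have htop : AddSubgroup.closure (DH : Set H) = ⊤ := by
    rw [coe_filter_univ]
    exact AddSubgroup.closure_closure_coe_preimage
  have hDH : #D ≤ #DH := card_le_card_of_surjOn ((↑) : H → G) fun d hd =>
    ⟨⟨d, AddSubgroup.subset_closure hd⟩, by simpa [DH] using hd, rfl⟩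
  have hUH : #UH ≤ #U := card_le_card_of_injOn (fun v => x + v)
    (fun v hv => by simpa [UH] using hv) fun v _ w _ hvw => Subtype.ext (add_left_cancel hvw)
  refine hψH.eq_of_closure_eq_top (U := UH) (x := 0) (y := ⟨-x + y, hxy⟩) (by simpa [DH] using h0)
    hnegH htop (fun v hv => (mem_filter_univ v).2 (hU _ hv)) (by omega) ?_ ?_
  · simpa using hx
  · simpa using hy

end TranslatePredictors

theorem card_le_natCard_pow_finrank {K M : Type*} [Field K] [AddCommGroup M] [Module K M]
    (V : Submodule K M) [Finite V] {D : Finset M} (hDV : (D : Set M) ⊆ V) :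
    D.card ≤ Nat.card K ^ Module.finrank K V := by
  rw [← Module.natCard_eq_pow_finrank, ← Set.ncard_coe_finset]
  exact Set.ncard_le_ncard hDV

section Protocols

open Finset
open scoped Pointwise

variable {n t p : ℕ} {f : PartialBoolFun n}

theorem HasNADT.hasOneWayProtocol (hf : HasNADT f p) : HasOneWayProtocol (xorFun f) p := by
  obtain ⟨s, l, hl⟩ := hf
  refine ⟨fun x i => s i ⬝ᵥ x, fun c y => l (c + fun i => s i ⬝ᵥ y), fun x y b hb => ?_⟩
  rw [← hl (x + y) b hb]
  exact congrArg l (funext fun i => (dotProduct_add (s i) x y).symm)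

theorem oneWayCC_le_nadt (f : PartialBoolFun n) : oneWayCC (xorFun f) ≤ nadt f :=
  Nat.sInf_le (Nat.sInf_mem (s := {p | HasNADT f p}) ⟨n, hasNADT_self f⟩).hasOneWayProtocol

theorem HasOneWayProtocol.exists_predictsTranslates (hF : HasOneWayProtocol (xorFun f) t)
    (htn : t ≤ n) :
    ∃ (ψ : Cube n → ZMod 2) (D : Finset (Cube n)),
      PredictsTranslates ψ f D ∧ 0 ∈ D ∧ 2 ^ (n - t) ≤ #D := by
  obtain ⟨h, φ, hφ⟩ := hF
  have hcube : Fintype.card (Cube t) * 2 ^ (n - t) ≤ Fintype.card (Cube n) := by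
    simp only [Fintype.card_fun, ZMod.card, Fintype.card_fin]
    rw [← pow_add, Nat.add_sub_cancel' htn]
  obtain ⟨c, hc⟩ := Fintype.exists_le_card_fiber_of_mul_le_card h hcube
  let A : Finset (Cube n) := {x | h x = c}
  obtain ⟨a₀, ha₀⟩ : A.Nonempty := card_pos.1 (hc.trans_lt' (by positivity))
  refine ⟨fun x => φ c (x + a₀), a₀ +ᵥ A, fun d hd x b hb => ?_, ?_, ?_⟩
  · obtain ⟨a, ha, rfl⟩ := mem_vadd_finset.1 hd
    have ha : h a = c := (mem_filter_univ a).1 ha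
    refine ha ▸ hφ a (x + a₀) b ?_
    rwa [xorFun, add_comm a, add_assoc]
  · exact mem_vadd_finset.2 ⟨a₀, ha₀, ZModModule.add_self a₀⟩
  · rwa [card_vadd_finset]

theorem hasNADT_of_linearMap (g : Cube n →ₗ[ZMod 2] Cube p)
    (hg : ∀ x y a b, g x = g y → f x = some a → f y = some b → a = b) : HasNADT f p := by
  let value (x : {x // (f x).isSome}) : ZMod 2 := (f x).get x.2
  have hfactor : value.FactorsThrough fun x => g x := fun x y hxy =>
    hg x y _ _ hxy (Option.some_get _).symm (Option.some_get _).symm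
  refine ⟨LinearMap.toMatrix' g, Function.extend (fun x : {x // (f x).isSome} => g x) value 0,
    fun x b hb => ?_⟩
  rw [show (fun i => LinearMap.toMatrix' g i ⬝ᵥ x) = g x from LinearMap.toMatrix'_mulVec g x]
  exact (hfactor.extend_apply 0 ⟨x, by simp [hb]⟩).trans (by simp [value, hb])

theorem hasNADT_of_const_on_cosets (V : Submodule (ZMod 2) (Cube n))
    (hV : n ≤ p + Module.finrank (ZMod 2) V)
    (hf : ∀ x y a b, -x + y ∈ V → f x = some a → f y = some b → a = b) : HasNADT f p := by
  have hrank : Module.finrank (ZMod 2) (Cube n ⧸ V) ≤ Module.finrank (ZMod 2) (Cube p) := by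
    have hadd := V.finrank_quotient_add_finrank
    rw [Module.finrank_fin_fun] at hadd ⊢
    omega
  obtain ⟨g, hg⟩ : ∃ g : (Cube n ⧸ V) →ₗ[ZMod 2] Cube p, Function.Injective g :=
    finrank_le_iff_exists_linearMap.1 hrank
  refine hasNADT_of_linearMap (g ∘ₗ V.mkQ) fun x y a b hxy => hf x y a b ?_
  exact QuotientAddGroup.eq.1 (hg hxy)

theorem HasOneWayProtocol.hasNADT (hF : HasOneWayProtocol (xorFun f) t) (htn : t ≤ n)
    (hU : #(undefinedInputs f) < 2 ^ (n - t)) : HasNADT f t := by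
  obtain ⟨ψ, D, hψ, h0, hD⟩ := hF.exists_predictsTranslates htn
  have hneg : -D = D := by
    ext d
    rw [mem_neg', ZModModule.neg_eq_self]
  let V := AddSubgroup.toZModSubmodule 2 (AddSubgroup.closure (D : Set (Cube n)))
  have hDV : #D ≤ 2 ^ Module.finrank (ZMod 2) V := by
    simpa only [Nat.card_zmod] using card_le_natCard_pow_finrank V AddSubgroup.subset_closure
  have hrank : n - t ≤ Module.finrank (ZMod 2) V :=
    (Nat.pow_le_pow_iff_right one_lt_two).1 (hD.trans hDV)
  refine hasNADT_of_const_on_cosets V (by omega) fun x y a b hxy => ?_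
  exact hψ.eq_of_neg_add_mem_closure h0 hneg (fun z hz => (mem_filter_univ z).2 hz)
    (hU.trans_le hD) hxy

end Protocols

section Asymptotics

open Asymptotics Filter
open scoped Real

theorem centralBinom_isEquivalent :
    (fun n : ℕ => (n.centralBinom : ℝ)) ~[atTop] fun n => 4 ^ n / √(π * n) := by
  have htwo : Tendsto (fun n : ℕ => 2 * n) atTop atTop := tendsto_id.const_mul_atTop' two_pos
  have hfact := Stirling.factorial_isEquivalent_stirling
  refine ((hfact.comp_tendsto htwo).div (hfact.mul hfact)).congr_left ?_ |>.congr_right ?_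
  · filter_upwards with n
    simp [Nat.centralBinom, two_mul, Nat.cast_add_choose]
  · filter_upwards [eventually_ne_atTop 0] with n hn
    have hsqrt : √(2 * (2 * n : ℕ) * π) = 2 * √(π * n) := by
      rw [← Real.sqrt_sq zero_le_two, ← Real.sqrt_mul (sq_nonneg _)]
      push_cast
      ring_nf
    have hsqrt_sq : √(2 * n * π) * √(2 * n * π) = 2 * √(π * n) ^ 2 := by
      rw [Real.mul_self_sqrt (by positivity), Real.sq_sqrt (by positivity)]
      ring
    have hpow : ((2 * n : ℕ) / Real.exp 1) ^ (2 * n) = 4 ^ n * ((n / Real.exp 1) ^ n) ^ 2 := by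
      rw [← pow_mul, mul_comm n 2, pow_mul _ 2 n, pow_mul _ 2 n, ← mul_pow]
      push_cast
      ring_nf
    simp only [Pi.div_apply, Pi.mul_apply, Function.comp_apply]
    rw [hsqrt, hpow, mul_mul_mul_comm √(2 * n * π), hsqrt_sq]
    field_simp

theorem undefinedThreshold_eq_choose {m : ℕ} (hm : 2 ≤ m) :
    undefinedThreshold m = (m + 1).choose (m / 2 - 1) := by
  have h : ((m : ℤ) / 2 - 1) = ((m / 2 - 1 : ℕ) : ℤ) := by omega
  rw [undefinedThreshold, intChoose, h, if_pos (Int.natCast_nonneg _), Int.toNat_natCast]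

theorem undefinedThreshold_le_two_pow (m : ℕ) : undefinedThreshold m ≤ 2 ^ m := by
  rw [undefinedThreshold, intChoose]
  split_ifs
  · exact Nat.choose_succ_le_two_pow m _
  · exact Nat.zero_le _

theorem undefinedThreshold_le_centralBinom {m : ℕ} (hm : 2 ≤ m) :
    undefinedThreshold m ≤ 4 * (m / 2).centralBinom := by
  rw [undefinedThreshold_eq_choose hm]
  calc (m + 1).choose (m / 2 - 1) ≤ (2 * (m / 2 + 1)).choose (m / 2 - 1) :=
        Nat.choose_le_choose _ (by omega)
    _ ≤ (m / 2 + 1).centralBinom := Nat.choose_le_centralBinom _ _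
    _ ≤ 4 * (m / 2).centralBinom := by
      have hsucc := Nat.succ_mul_centralBinom_succ (m / 2)
      refine Nat.le_of_mul_le_mul_left ?_ (m / 2).succ_pos
      rw [Nat.succ_eq_add_one, hsucc]
      nlinarith

theorem centralBinom_le_undefinedThreshold {m : ℕ} (hm : 2 ≤ m) :
    (m / 2).centralBinom ≤ 2 * undefinedThreshold m := by
  obtain ⟨k, hk⟩ : ∃ k, m / 2 = k + 1 := ⟨m / 2 - 1, by omega⟩
  have hstep : (2 * (k + 1)).choose (k + 1) * (k + 1) = (2 * (k + 1)).choose k * (k + 2) := by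
    rw [Nat.choose_succ_right_eq, show 2 * (k + 1) - k = k + 2 by omega]
  have hmono : (2 * (k + 1)).choose k ≤ (m + 1).choose k := Nat.choose_le_choose _ (by omega)
  rw [undefinedThreshold_eq_choose hm, hk, Nat.add_sub_cancel,
    Nat.centralBinom_eq_two_mul_choose]
  nlinarith

theorem undefinedThreshold_isTheta_centralBinom :
    (fun m => (undefinedThreshold m : ℝ)) =Θ[atTop] fun m => ((m / 2).centralBinom : ℝ) := by
  refine ⟨.of_bound 4 ?_, .of_bound 2 ?_⟩ <;> filter_upwards [eventually_ge_atTop 2] with m hm <;>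
    rw [RCLike.norm_natCast, RCLike.norm_natCast]
  · exact_mod_cast undefinedThreshold_le_centralBinom hm
  · exact_mod_cast centralBinom_le_undefinedThreshold hm

theorem natCast_div_two_isTheta : (fun m : ℕ => ((m / 2 : ℕ) : ℝ)) =Θ[atTop] fun m => (m : ℝ) := by
  refine ⟨.of_bound 1 ?_, .of_bound 3 ?_⟩ <;> filter_upwards [eventually_ge_atTop 2] with m hm <;>
    rw [RCLike.norm_natCast, RCLike.norm_natCast] <;> norm_cast <;> omega

theorem four_pow_div_two_isTheta :
    (fun m : ℕ => (4 : ℝ) ^ (m / 2)) =Θ[atTop] fun m => (2 : ℝ) ^ m := by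
  have hfour (m : ℕ) : (4 : ℝ) ^ (m / 2) = 2 ^ (2 * (m / 2)) := by rw [pow_mul]; norm_num
  refine ⟨.of_bound 1 (.of_forall fun m => ?_), .of_bound 2 (.of_forall fun m => ?_)⟩ <;>
    rw [hfour, Real.norm_of_nonneg (by positivity), Real.norm_of_nonneg (by positivity)]
  · rw [one_mul]
    gcongr
    · exact one_le_two
    · omega
  · rw [← pow_succ']
    gcongr
    · exact one_le_two
    · omega

theorem undefinedThreshold_isTheta :
    (fun m : ℕ => (undefinedThreshold m : ℝ)) =Θ[atTop] fun m : ℕ => (2 : ℝ) ^ m / √(m : ℝ) := by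
  have hhalf : Tendsto (fun m : ℕ => m / 2) atTop atTop :=
    Nat.tendsto_div_const_atTop two_ne_zero
  have hsqrt : (fun m : ℕ => √(π * (m / 2 : ℕ))) =Θ[atTop] fun m => √(m : ℝ) :=
    (natCast_div_two_isTheta.const_mul_left Real.pi_ne_zero).sqrt
      (.of_forall fun m => by positivity) (.of_forall fun m => by positivity)
  exact undefinedThreshold_isTheta_centralBinom.trans <|
    (centralBinom_isEquivalent.comp_tendsto hhalf).isTheta.trans <|
      four_pow_div_two_isTheta.div hsqrt

end Asymptotics

theorem mainTheorem1_general {n t : ℕ} {f : PartialBoolFun n} (ht : oneWayCC (xorFun f) = t)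
    (hU : (undefinedInputs f).card < 2 ^ (n - t)) : nadt f = t := by
  have hF : HasOneWayProtocol (xorFun f) t :=
    ht ▸ Nat.sInf_mem (s := {t | HasOneWayProtocol (xorFun f) t}) ⟨n, hasOneWayProtocol_self _⟩
  have htn : t ≤ n := ht ▸ Nat.sInf_le (hasOneWayProtocol_self _)
  exact le_antisymm (Nat.sInf_le (hF.hasNADT htn hU)) (ht ▸ oneWayCC_le_nadt f)

theorem mainTheorem1 :
    (∀ (n t : ℕ) (f : PartialBoolFun n),
      oneWayCC (xorFun f) = t →
      (undefinedInputs f).card < undefinedThreshold (n - t) →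
      nadt f = t) ∧
    Asymptotics.IsTheta Filter.atTop
      (fun m : ℕ => (undefinedThreshold m : ℝ))
      (fun m : ℕ => (2 : ℝ) ^ m / Real.sqrt (m : ℝ)) :=
  ⟨fun _ _ _ ht hU => mainTheorem1_general ht (hU.trans_le (undefinedThreshold_le_two_pow _)),
    undefinedThreshold_isTheta⟩
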